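/- Let $R$ be a commutative Noetherian ring. For a proper ideal $I$ of a commutative ring $A$ and an $A$-module $M$ with $IM\neq M$, let $\operatorname{grade}(I,M)$ be the supremum of the lengths of the $M$-regular sequences consisting of elements of $I$; $M$ is called $I$-Cohen Macaulay if $\operatorname{grade}(I,M)+\dim_A(M/IM)=\dim_A M$, where $\dim_A$ of a module is the Krull dimension of its support. For an ideal $I$ of $R$, let $I[x_1,\dots,x_n]$ and $I[[x_1,\dots,x_n]]$ be the ideals of $R[x_1,\dots,x_n]$ and $R[[x_1,\dots,x_n]]$ consisting of the polynomials, respectively the formal power series, all of whose coefficients lie in $I$. Let $I$ be a proper ideal of $R$ and $\mathfrak p$ a prime ideal of $R$ such that $\operatorname{grade}(I,R)=\operatorname{height}(I)$ and $\operatorname{grade}(\mathfrak p,R)=\operatorname{height}(\mathfrak p)$. Then, for every $n\ge 0$: 1. $R$ is $I$-Cohen Macaulay if and only if $R[[x_1,\dots,x_n]]$ is $I[[x_1,\dots,x_n]]$-Cohen Macaulay. 2. $R$ is $\mathfrak p$-Cohen Macaulay if and only if $R[x_1,\dots,x_n]$ is $\mathfrak p[x_1,\dots,x_n]$-Cohen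 Macaulay. -/

import Mathlib

noncomputable section

/-- The grade of an ideal `I` on a module `M`: the supremum of the lengths of the `M`-regular
sequences with all terms in `I`, and `∞` (the usual convention) when `I M = M`. -/
def Ideal.gradeOn {R : Type*} [CommRing R] (I : Ideal R) (M : Type*) [AddCommGroup M]
    [Module R M] : ℕ∞ :=
  open Classical in
  if I • (⊤ : Submodule R M) = ⊤ then ⊤
  else ⨆ rs : {rs : List R // (∀ r ∈ rs, r ∈ I) ∧ RingTheory.Sequence.IsRegular M rs},
    (rs.1.length : ℕ∞)

/-- For a proper ideal `I` of `R`, the module `M` is `I`-Cohen Macaulay if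
`grade(I, M) + dim (M / I M) = dim M`, where the dimension of a module is the Krull dimension of
its support. -/
def IsIdealCohenMacaulay {R : Type*} [CommRing R] (I : Ideal R) (M : Type*) [AddCommGroup M]
    [Module R M] : Prop :=
  ((I.gradeOn M : ℕ∞) : WithBot ℕ∞) + Module.supportDim R (M ⧸ (I • (⊤ : Submodule R M)))
    = Module.supportDim R M

/-- `I[x]`: the ideal of the polynomials all of whose coefficients lie in `I`. -/
def Ideal.mvPolynomialCoeffs {R : Type*} [CommRing R] (σ : Type*) (I : Ideal R) :
    Ideal (MvPolynomial σ R) where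
  carrier := {f | ∀ m, MvPolynomial.coeff m f ∈ I}
  zero_mem' m := by simp
  add_mem' hf hg m := by
    rw [MvPolynomial.coeff_add]
    exact I.add_mem (hf m) (hg m)
  smul_mem' c f hf m := by
    classical
    rw [smul_eq_mul, MvPolynomial.coeff_mul]
    exact I.sum_mem fun i _ => I.mul_mem_left _ (hf i.2)

/-- `I[[x]]`: the ideal of the formal power series all of whose coefficients lie in `I`. -/
def Ideal.mvPowerSeriesCoeffs {R : Type*} [CommRing R] (σ : Type*) (I : Ideal R) :
    Ideal (MvPowerSeries σ R) where
  carrier := {f | ∀ m, MvPowerSeries.coeff m f ∈ I}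
  zero_mem' m := by simp
  add_mem' hf hg m := by
    rw [map_add]
    exact I.add_mem (hf m) (hg m)
  smul_mem' c f hf m := by
    classical
    rw [smul_eq_mul, MvPowerSeries.coeff_mul]
    exact I.sum_mem fun i _ => I.mul_mem_left _ (hf i.2)

end

open RingTheory.Sequence

section Dimension

/-! Let `S` be the polynomial or power series ring in `n` variables. Its dimension is that of `R`
plus `n`, and `S ⧸ IS` is the same kind of ring over `R ⧸ I`, so its dimension is also shifted by
`n`. Hence it suffices that `I` and `IS` have the same grade. Regular sequences in `I` stay regular
in `S`, as regularity can be checked coefficientwise; this gives one inequality. Conversely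
grade(`IS`) ≤ height(`IS`) ≤ height(`I`) = grade(`I`), the last equality being the hypothesis.
`HasCoefficients` collects what this argument uses of `S`. -/

lemma PowerSeries.X_mem_ringJacobson (R : Type*) [CommRing R] :
    (PowerSeries.X : PowerSeries R) ∈ Ring.jacobson (PowerSeries R) := by
  rw [← Ideal.jacobson_bot, Ideal.mem_jacobson_bot]
  intro y
  rw [PowerSeries.isUnit_iff_constantCoeff]
  simp

lemma PowerSeries.ringKrullDim_of_isNoetherianRing (R : Type*) [CommRing R] [IsNoetherianRing R] :
    ringKrullDim (PowerSeries R) = ringKrullDim R + 1 := by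
  have hreg : IsSMulRegular (PowerSeries R) (PowerSeries.X : PowerSeries R) :=
    Module.Flat.isSMulRegular_of_nonZeroDivisors MvPowerSeries.X_mem_nonzeroDivisors
  -- Dividing by a nonzerodivisor in the Jacobson radical lowers the dimension by exactly one, and
  -- modulo `X` only `R` remains.
  rw [← ringKrullDim_quotient_span_singleton_succ_eq_ringKrullDim_of_mem_jacobson hreg
    (PowerSeries.X_mem_ringJacobson R)]
  have hker : RingHom.ker (PowerSeries.constantCoeff (R := R)) = Ideal.span {PowerSeries.X} := by
    ext f
    rw [RingHom.mem_ker, Ideal.mem_span_singleton, PowerSeries.X_dvd_iff]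
  rw [ringKrullDim_eq_of_ringEquiv ((Ideal.quotEquivOfEq hker.symm).trans
    (RingHom.quotientKerEquivOfSurjective (f := PowerSeries.constantCoeff (R := R))
      fun r => ⟨PowerSeries.C r, PowerSeries.constantCoeff_C r⟩))]

lemma MvPowerSeries.ringKrullDim_fin_of_isNoetherianRing (R : Type*) [CommRing R]
    [IsNoetherianRing R] (n : ℕ) :
    ringKrullDim (MvPowerSeries (Fin n) R) = ringKrullDim R + n := by
  induction n with
  | zero =>
    rw [ringKrullDim_eq_of_ringEquiv (MvPowerSeries.isEmptyEquiv (Fin 0) R).toRingEquiv]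
    simp
  | succ n ih =>
    rw [ringKrullDim_eq_of_ringEquiv (MvPowerSeries.finSuccEquiv R n).toRingEquiv,
      PowerSeries.ringKrullDim_of_isNoetherianRing, ih, add_assoc]
    push_cast
    rfl

end Dimension

section Grade

/-- After localizing at a minimal prime `p` of `I` the sequence is regular in a local ring, so its
length is a drop in dimension from `p.height` to that of a nonzero quotient. -/
lemma RingTheory.Sequence.IsWeaklyRegular.length_le_height {R : Type*} [CommRing R]
    [IsNoetherianRing R] {rs : List R} (reg : IsWeaklyRegular R rs) {I : Ideal R}
    (mem : ∀ r ∈ rs, r ∈ I) : (rs.length : ℕ∞) ≤ I.height := by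
  rw [I.height_eq_inf_minimalPrimes]
  refine le_iInf₂ fun p hp => ?_
  have := hp.1.1
  have hreg : IsRegular (Localization.AtPrime p) _ :=
    reg.isRegular_of_isLocalization_of_mem (Localization.AtPrime p) p fun r hr => hp.1.2 (mem r hr)
  have hle := ringKrullDim_add_length_eq_ringKrullDim_of_isRegular _ hreg
  rw [IsLocalization.AtPrime.ringKrullDim_eq_height p (Localization.AtPrime p),
    List.length_map] at hle
  have : Nontrivial (Localization.AtPrime p ⧸
      Ideal.ofList (rs.map (algebraMap R (Localization.AtPrime p)))) := by
    rw [Ideal.Quotient.nontrivial_iff]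
    simpa using hreg.top_ne_smul.symm
  have h0 := ringKrullDim_nonneg_of_nontrivial (R := Localization.AtPrime p ⧸
      Ideal.ofList (rs.map (algebraMap R (Localization.AtPrime p))))
  have : ((rs.length : ℕ∞) : WithBot ℕ∞) ≤ (p.height : WithBot ℕ∞) := by
    rw [← hle]
    exact le_add_of_nonneg_left h0
  exact_mod_cast this

lemma Ideal.gradeOn_self_of_ne_top {R : Type*} [CommRing R] {I : Ideal R} (hI : I ≠ ⊤) :
    I.gradeOn R = ⨆ rs : {rs : List R // (∀ r ∈ rs, r ∈ I) ∧ IsRegular R rs},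
      (rs.1.length : ℕ∞) := by
  rw [Ideal.gradeOn, if_neg]
  simpa using hI

lemma Ideal.gradeOn_self_le_height {R : Type*} [CommRing R] [IsNoetherianRing R] {I : Ideal R}
    (hI : I ≠ ⊤) : I.gradeOn R ≤ I.height := by
  rw [Ideal.gradeOn_self_of_ne_top hI]
  exact iSup_le fun rs => rs.2.2.1.length_le_height rs.2.1

lemma isIdealCohenMacaulay_self_iff {R : Type*} [CommRing R] (I : Ideal R) :
    IsIdealCohenMacaulay I R ↔
      ((I.gradeOn R : ℕ∞) : WithBot ℕ∞) + ringKrullDim (R ⧸ I) = ringKrullDim R := by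
  rw [IsIdealCohenMacaulay, Module.supportDim_self_eq_ringKrullDim, smul_eq_mul, Ideal.mul_top,
    Module.supportDim_quotient_eq_ringKrullDim]

end Grade

section Coefficients

/-- An `R`-algebra `S` has *coefficient maps* `c` when membership in an extended ideal `J S` is
tested by the `R`-linear maps `c i : S → R`, as for polynomial and power series rings. -/
structure HasCoefficients (R : Type*) {S ι : Type*} [CommRing R] [CommRing S] [Algebra R S]
    (c : ι → S →ₗ[R] R) : Prop where
  mem_map_iff (J : Ideal R) (f : S) : f ∈ J.map (algebraMap R S) ↔ ∀ i, c i f ∈ J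
  isPrime_map (p : Ideal R) [p.IsPrime] : (p.map (algebraMap R S)).IsPrime

namespace HasCoefficients

variable {R S ι : Type*} [CommRing R] [CommRing S] [Algebra R S] {c : ι → S →ₗ[R] R}

lemma map_ne_top (hc : HasCoefficients R c) {I : Ideal R} (hI : I ≠ ⊤) :
    I.map (algebraMap R S) ≠ ⊤ := by
  obtain ⟨m, hm, hIm⟩ := I.exists_le_maximal hI
  have := hc.isPrime_map m
  exact ne_top_of_le_ne_top this.ne_top (Ideal.map_mono hIm)

lemma liesOver_map (hc : HasCoefficients R c) (p : Ideal R) [p.IsPrime] :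
    (p.map (algebraMap R S)).LiesOver p := by
  refine ⟨le_antisymm Ideal.le_comap_map fun r hr => ?_⟩
  -- Some coefficient of `1` avoids `p`; by linearity the same coefficient of `r` is `r * c i 1`,
  -- which detects `r ∈ p`.
  obtain ⟨i, hi⟩ : ∃ i, c i 1 ∉ p := by
    by_contra! h
    exact (hc.isPrime_map p).one_notMem ((hc.mem_map_iff p 1).2 h)
  have h := (hc.mem_map_iff p _).1 hr i
  rw [Algebra.algebraMap_eq_smul_one, map_smul, smul_eq_mul] at h
  exact ((‹p.IsPrime›).mem_or_mem h).resolve_right hi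

/-- For `p` minimal over `I`, the prime `pS` lies over `p` and is zero in the fibre `S ⧸ pS`, so its
height is at most that of `p`. -/
lemma height_map_le [IsNoetherianRing R] [IsNoetherianRing S] (hc : HasCoefficients R c)
    (I : Ideal R) : (I.map (algebraMap R S)).height ≤ I.height := by
  rw [I.height_eq_inf_minimalPrimes]
  refine le_iInf₂ fun p hp => ?_
  have := hp.1.1
  have := hc.isPrime_map p
  have := hc.liesOver_map p
  have h := Ideal.height_le_height_add_of_liesOver p (p.map (algebraMap R S))
  rw [Ideal.map_quotient_self, Ideal.height_bot, add_zero] at h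
  exact (Ideal.height_mono (Ideal.map_mono hp.1.2)).trans h

/-- Multiplication by an element of `R` commutes with every `c i`, so each regularity condition
reduces to the one in `R`, coefficient by coefficient. -/
lemma isWeaklyRegular_map (hc : HasCoefficients R c) {rs : List R} (reg : IsWeaklyRegular R rs) :
    IsWeaklyRegular S (rs.map (algebraMap R S)) := by
  refine ⟨fun i hi => ?_⟩
  have hi' : i < rs.length := by simpa using hi
  have h := reg.regular_mod_prev i hi'
  rw [isSMulRegular_quotient_iff_mem_of_smul_mem, smul_eq_mul, Ideal.mul_top] at h ⊢
  rw [← List.map_take, ← Ideal.map_ofList]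
  intro f hf
  rw [hc.mem_map_iff] at hf ⊢
  intro j
  refine h _ ?_
  have := hf j
  rwa [List.getElem_map, smul_eq_mul, ← Algebra.smul_def, map_smul] at this

lemma isRegular_map (hc : HasCoefficients R c) {rs : List R} (reg : IsRegular R rs) :
    IsRegular S (rs.map (algebraMap R S)) := by
  refine ⟨hc.isWeaklyRegular_map reg.1, ?_⟩
  rw [← Ideal.map_ofList, smul_eq_mul, Ideal.mul_top]
  refine (hc.map_ne_top ?_).symm
  simpa using reg.top_ne_smul.symm

lemma gradeOn_le_gradeOn_map (hc : HasCoefficients R c) {I : Ideal R} (hI : I ≠ ⊤) :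
    I.gradeOn R ≤ (I.map (algebraMap R S)).gradeOn S := by
  rw [Ideal.gradeOn_self_of_ne_top hI, Ideal.gradeOn_self_of_ne_top (hc.map_ne_top hI)]
  refine iSup_le fun rs => ?_
  refine le_iSup_of_le ⟨rs.1.map (algebraMap R S), ?_, hc.isRegular_map rs.2.2⟩ (by simp)
  simp only [List.mem_map, forall_exists_index, and_imp, forall_apply_eq_imp_iff₂]
  exact fun r hr => Ideal.mem_map_of_mem _ (rs.2.1 r hr)

lemma gradeOn_map_eq [IsNoetherianRing R] [IsNoetherianRing S] (hc : HasCoefficients R c)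
    {I : Ideal R} (hI : I ≠ ⊤) (hg : I.gradeOn R = I.height) :
    (I.map (algebraMap R S)).gradeOn S = I.gradeOn R :=
  le_antisymm (((Ideal.gradeOn_self_le_height (hc.map_ne_top hI)).trans (hc.height_map_le I)).trans
    hg.ge) (hc.gradeOn_le_gradeOn_map hI)

lemma isIdealCohenMacaulay_iff [IsNoetherianRing R] [IsNoetherianRing S]
    (hc : HasCoefficients R c) {I : Ideal R} (hI : I ≠ ⊤) (hg : I.gradeOn R = I.height) {n : ℕ}
    (hdim : ringKrullDim S = ringKrullDim R + n)
    (hdimI : ringKrullDim (S ⧸ I.map (algebraMap R S)) = ringKrullDim (R ⧸ I) + n) :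
    IsIdealCohenMacaulay I R ↔ IsIdealCohenMacaulay (I.map (algebraMap R S)) S := by
  -- The shift `n` is finite, so it cancels even when the dimensions are infinite.
  rw [isIdealCohenMacaulay_self_iff, isIdealCohenMacaulay_self_iff, hc.gradeOn_map_eq hI hg, hdim,
    hdimI, ← add_assoc, ENat.WithBot.add_natCast_cancel]

end HasCoefficients

end Coefficients

section MvPowerSeries

variable {R : Type*} [CommRing R] (σ : Type*)

lemma Ideal.mvPowerSeriesCoeffs_eq_ker (I : Ideal R) :
    I.mvPowerSeriesCoeffs σ = RingHom.ker (MvPowerSeries.map (σ := σ) (Ideal.Quotient.mk I)) := by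
  ext f
  rw [RingHom.mem_ker, MvPowerSeries.ext_iff]
  simp only [MvPowerSeries.coeff_map, map_zero, Ideal.Quotient.eq_zero_iff_mem]
  rfl

/-- A power series may have infinitely many coefficients; expanding all of them in one finite
generating set of `I` makes the series a finite combination of these generators. -/
lemma Ideal.map_algebraMap_mvPowerSeries [IsNoetherianRing R] (I : Ideal R) :
    I.map (algebraMap R (MvPowerSeries σ R)) = I.mvPowerSeriesCoeffs σ := by
  refine le_antisymm ?_ fun f hf => ?_
  · rw [Ideal.map_le_iff_le_comap]
    intro r hr m
    classical
    rw [MvPowerSeries.algebraMap_apply, Algebra.algebraMap_self, RingHom.id_apply,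
      MvPowerSeries.coeff_C]
    split_ifs
    exacts [hr, I.zero_mem]
  · obtain ⟨s, rfl⟩ : I.FG := IsNoetherian.noetherian I
    have hf' : ∀ m, ∃ g : R → R, ∑ a ∈ s, g a • a = MvPowerSeries.coeff m f := fun m => by
      obtain ⟨g, -, hg⟩ := Submodule.mem_span_finset.1 (hf m)
      exact ⟨g, hg⟩
    choose g hg using hf'
    have : f = ∑ a ∈ s, (show MvPowerSeries σ R from fun m => g m a) *
        algebraMap R (MvPowerSeries σ R) a := by
      ext m
      rw [← hg, map_sum]
      refine Finset.sum_congr rfl fun a _ => ?_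
      rw [mul_comm, ← Algebra.smul_def, MvPowerSeries.coeff_smul, mul_comm]
      rfl
    rw [this]
    exact Ideal.sum_mem _ fun a ha =>
      Ideal.mul_mem_left _ _ (Ideal.mem_map_of_mem _ (Ideal.subset_span ha))

lemma MvPowerSeries.hasCoefficients [IsNoetherianRing R] :
    HasCoefficients R (MvPowerSeries.coeff (σ := σ) (R := R)) where
  mem_map_iff J f := by
    rw [J.map_algebraMap_mvPowerSeries σ]
    rfl
  isPrime_map p _ := by
    rw [p.map_algebraMap_mvPowerSeries σ, p.mvPowerSeriesCoeffs_eq_ker σ]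
    -- The ideal is the kernel of reduction modulo `p`, whose target is a domain.
    have : IsDomain (MvPowerSeries σ (R ⧸ p)) := NoZeroDivisors.to_isDomain _
    exact RingHom.ker_isPrime _

lemma MvPowerSeries.map_surjective_of_surjective {A : Type*} [CommRing A] {f : R →+* A}
    (hf : Function.Surjective f) : Function.Surjective (MvPowerSeries.map (σ := σ) f) := by
  intro g
  choose h hh using hf
  refine ⟨show MvPowerSeries σ R from fun m => h (MvPowerSeries.coeff m g), ?_⟩
  ext m
  rw [MvPowerSeries.coeff_map]
  exact hh _

lemma MvPowerSeries.ringKrullDim_quotient_coeffs [IsNoetherianRing R] (I : Ideal R) (n : ℕ) :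
    ringKrullDim (MvPowerSeries (Fin n) R ⧸ I.mvPowerSeriesCoeffs (Fin n)) =
      ringKrullDim (R ⧸ I) + n := by
  rw [← MvPowerSeries.ringKrullDim_fin_of_isNoetherianRing]
  exact ringKrullDim_eq_of_ringEquiv
    ((Ideal.quotEquivOfEq (I.mvPowerSeriesCoeffs_eq_ker (Fin n))).trans
      (RingHom.quotientKerEquivOfSurjective
        (MvPowerSeries.map_surjective_of_surjective _ Ideal.Quotient.mk_surjective)))

end MvPowerSeries

section MvPolynomial

variable {R : Type*} [CommRing R] (σ : Type*)

lemma Ideal.mvPolynomialCoeffs_eq_ker (I : Ideal R) :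
    I.mvPolynomialCoeffs σ = RingHom.ker (MvPolynomial.map (σ := σ) (Ideal.Quotient.mk I)) := by
  ext f
  rw [RingHom.mem_ker, MvPolynomial.ext_iff]
  simp only [MvPolynomial.coeff_map, MvPolynomial.coeff_zero, Ideal.Quotient.eq_zero_iff_mem]
  rfl

lemma Ideal.map_algebraMap_mvPolynomial (I : Ideal R) :
    I.map (algebraMap R (MvPolynomial σ R)) = I.mvPolynomialCoeffs σ := by
  ext f
  exact MvPolynomial.mem_map_C_iff

lemma MvPolynomial.hasCoefficients :
    HasCoefficients R (MvPolynomial.lcoeff R (σ := σ)) where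
  mem_map_iff J f := by
    rw [J.map_algebraMap_mvPolynomial σ]
    rfl
  isPrime_map p _ := by
    rw [p.map_algebraMap_mvPolynomial σ, p.mvPolynomialCoeffs_eq_ker σ]
    exact RingHom.ker_isPrime _

lemma MvPolynomial.ringKrullDim_quotient_coeffs [IsNoetherianRing R] (I : Ideal R) (n : ℕ) :
    ringKrullDim (MvPolynomial (Fin n) R ⧸ I.mvPolynomialCoeffs (Fin n)) =
      ringKrullDim (R ⧸ I) + n := by
  have h := MvPolynomial.ringKrullDim_of_isNoetherianRing (R := R ⧸ I) (ι := Fin n)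
  rw [Nat.card_fin] at h
  rw [← h]
  exact ringKrullDim_eq_of_ringEquiv
    ((Ideal.quotEquivOfEq (I.mvPolynomialCoeffs_eq_ker (Fin n))).trans
      (RingHom.quotientKerEquivOfSurjective
        (MvPolynomial.map_surjective _ Ideal.Quotient.mk_surjective)))

end MvPolynomial

theorem corollary5p1 {R : Type*} [CommRing R] [IsNoetherianRing R]
    (I : Ideal R) (hI : I ≠ ⊤) (p : Ideal R) (hp : p.IsPrime)
    (hgI : I.gradeOn R = I.height) (hgp : p.gradeOn R = p.height) (n : ℕ) :
    (IsIdealCohenMacaulay I R ↔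
      IsIdealCohenMacaulay (I.mvPowerSeriesCoeffs (Fin n)) (MvPowerSeries (Fin n) R)) ∧
    (IsIdealCohenMacaulay p R ↔
      IsIdealCohenMacaulay (p.mvPolynomialCoeffs (Fin n)) (MvPolynomial (Fin n) R)) := by
  constructor
  · rw [← I.map_algebraMap_mvPowerSeries (Fin n)]
    refine (MvPowerSeries.hasCoefficients (Fin n)).isIdealCohenMacaulay_iff hI hgI
      (MvPowerSeries.ringKrullDim_fin_of_isNoetherianRing R n) ?_
    rw [I.map_algebraMap_mvPowerSeries (Fin n)]
    exact MvPowerSeries.ringKrullDim_quotient_coeffs I n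
  · rw [← p.map_algebraMap_mvPolynomial (Fin n)]
    refine (MvPolynomial.hasCoefficients (Fin n)).isIdealCohenMacaulay_iff hp.ne_top hgp
      (n := n) (by simp [MvPolynomial.ringKrullDim_of_isNoetherianRing]) ?_
    rw [p.map_algebraMap_mvPolynomial (Fin n)]
    exact MvPolynomial.ringKrullDim_quotient_coeffs p n
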